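/- Let $\mathcal{A}$ be an abelian category and let $\mathrm{Ch}(\mathcal{A})$ be the category of ($\mathbb{Z}$-indexed) chain complexes over $\mathcal{A}$. Let $(\mathcal{Q},\mathcal{W},\mathcal{R})$ be a Hovey triple in $\mathrm{Ch}(\mathcal{A})$; that is, $\mathcal{W}$ is a thick class of complexes (closed under direct summands, and containing the third term of a short exact sequence as soon as it contains two of its terms), and $(\mathcal{Q},\mathcal{W}\cap\mathcal{R})$ and $(\mathcal{Q}\cap\mathcal{W},\mathcal{R})$ are complete cotorsion pairs in $\mathrm{Ch}(\mathcal{A})$. Assume that its core $\mathcal{Q}\cap\mathcal{W}\cap\mathcal{R}$ is closed under all suspensions $\Sigma^n$, $n\in\mathbb{Z}$, where $(\Sigma^nX)_k=X_{k-n}$ with differential $(-1)^n d$. 1. Every complex in $\mathcal{Q}\cap\mathcal{W}\cap\mathcal{R}$ is contractible, i.e. its identity map is chain homotopic to $0$. 2. Assume moreover that $\mathcal{W}$ contains all contractible complexes. Call a morphism a trivial cofibration if it is a monomorphism with cokernel in $\mathcal{Q}\cap\mathcal{W}$, a trivial fibration if it is an epimorphism with kernel in $\mathcal{W}\cap\mathcal{R}$,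 and a weak equivalence if it factors as a trivial cofibration followed by a trivial fibration. Let $\gamma:\mathrm{Ch}(\mathcal{A})\to\mathrm{Ho}$ be a localization of $\mathrm{Ch}(\mathcal{A})$ at the weak equivalences (the homotopy category of the triple). Then: (a) For all complexes $X,Y$, every cofibrant replacement $p:QX\to X$ (a trivial fibration with $QX\in\mathcal{Q}$) and every fibrant replacement $i:Y\to RY$ (a trivial cofibration with $RY\in\mathcal{R}$), there is a bijection $$\mathrm{Hom}_{\mathrm{Ch}(\mathcal{A})}(QX,RY)/\!\sim\ \;\cong\;\mathrm{Hom}_{\mathrm{Ho}}(\gamma X,\gamma Y),\qquad [f]\mapsto \gamma(i)^{-1}\circ\gamma(f)\circ\gamma(p)^{-1},$$ where $\sim$ is the usual chain homotopy relation. (b) Let $K(\mathcal{Q}\cap\mathcal{R})$ be the full subcategory of the chain homotopy category $K(\mathcal{A})$ consisting of the complexes in $\mathcal{Q}\cap\mathcal{R}$. The inclusion $\mathcal{Q}\cap\mathcal{R}\hookrightarrow\mathrm{Ch}(\mathcal{A})$ induces an equivalence of categories $K(\mathcal{Q}\cap\mathcal{R})\simeq\mathrm{Ho}$; that is, there is an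 equivalence whose composite with the canonical functor $\mathcal{Q}\cap\mathcal{R}\to K(\mathcal{Q}\cap\mathcal{R})$ is naturally isomorphic to the restriction of $\gamma$ to $\mathcal{Q}\cap\mathcal{R}$. -/

import Mathlib

open CategoryTheory CategoryTheory.Limits

universe u v u' v'

namespace HoveyModel

section Abelian

variable {C : Type u} [Category.{v} C] [Abelian C]

/-- Vanishing of the Yoneda group `Ext¹(X, Y)`, whose elements are the classes of short exact
sequences `0 ⟶ Y ⟶ E ⟶ X ⟶ 0`: every such sequence splits. -/
def ExtOneVanishes (X Y : C) : Prop :=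
  ∀ ⦃E : C⦄ (i : Y ⟶ E) (p : E ⟶ X) (w : i ≫ p = 0),
    (ShortComplex.mk i p w).ShortExact → Nonempty (ShortComplex.mk i p w).Splitting

/-- A cotorsion pair: each class is the `Ext¹`-orthogonal of the other. -/
structure IsCotorsionPair (X Y : ObjectProperty C) : Prop where
  left_iff : ∀ M : C, X M ↔ ∀ N : C, Y N → ExtOneVanishes M N
  right_iff : ∀ N : C, Y N ↔ ∀ M : C, X M → ExtOneVanishes M N

/-- A complete cotorsion pair: every object `M` admits short exact sequences
`0 ⟶ N ⟶ L ⟶ M ⟶ 0` and `0 ⟶ M ⟶ N' ⟶ L' ⟶ 0` with `L`, `L'` in the left class and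
`N`, `N'` in the right class. -/
structure IsCompleteCotorsionPair (X Y : ObjectProperty C) : Prop
    extends IsCotorsionPair X Y where
  enough_left : ∀ M : C, ∃ (N L : C) (i : N ⟶ L) (p : L ⟶ M) (w : i ≫ p = 0),
    X L ∧ Y N ∧ (ShortComplex.mk i p w).ShortExact
  enough_right : ∀ M : C, ∃ (N' L' : C) (i : M ⟶ N') (p : N' ⟶ L') (w : i ≫ p = 0),
    X L' ∧ Y N' ∧ (ShortComplex.mk i p w).ShortExact

/-- A thick class of objects: closed under direct summands (in an abelian category the same as
retracts), and if two of the three terms of a short exact sequence are in it, so is the third. -/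
structure IsThick (W : ObjectProperty C) : Prop where
  of_retract : ∀ ⦃M N : C⦄, Retract M N → W N → W M
  third : ∀ S : ShortComplex C, S.ShortExact → W S.X₁ → W S.X₂ → W S.X₃
  second : ∀ S : ShortComplex C, S.ShortExact → W S.X₁ → W S.X₃ → W S.X₂
  first : ∀ S : ShortComplex C, S.ShortExact → W S.X₂ → W S.X₃ → W S.X₁

/-- A Hovey triple `(Q, W, R)`: the class `W` is thick and both `(Q, W ∩ R)` and `(Q ∩ W, R)` are
complete cotorsion pairs. -/
structure IsHoveyTriple (Q W R : ObjectProperty C) : Prop where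
  thick : IsThick W
  cof_trivFib : IsCompleteCotorsionPair Q (W ⊓ R)
  trivCof_fib : IsCompleteCotorsionPair (Q ⊓ W) R

/-- The core `Q ∩ W ∩ R`. -/
def core (Q W R : ObjectProperty C) : ObjectProperty C := Q ⊓ W ⊓ R

/-- Trivial cofibrations: monomorphisms whose cokernel is trivially cofibrant. -/
def trivialCofibrations (Q W : ObjectProperty C) : MorphismProperty C :=
  fun _ _ f => Mono f ∧ (Q ⊓ W) (cokernel f)

/-- Trivial fibrations: epimorphisms whose kernel is trivially fibrant. -/
def trivialFibrations (W R : ObjectProperty C) : MorphismProperty C :=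
  fun _ _ f => Epi f ∧ (W ⊓ R) (kernel f)

/-- Weak equivalences: the morphisms that factor as a trivial cofibration followed by a trivial
fibration. -/
def weakEquivalences (Q W R : ObjectProperty C) : MorphismProperty C :=
  fun X Y f => ∃ (Z : C) (i : X ⟶ Z) (p : Z ⟶ Y),
    trivialCofibrations Q W i ∧ trivialFibrations W R p ∧ i ≫ p = f

/-- `p : QX ⟶ X` is a cofibrant replacement of `X`: the object `QX` is cofibrant and `p` is a
trivial fibration. -/
def IsCofibrantReplacement (Q W R : ObjectProperty C) {QX X : C} (p : QX ⟶ X) : Prop :=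
  Q QX ∧ trivialFibrations W R p

/-- `i : Y ⟶ RY` is a fibrant replacement of `Y`: the object `RY` is fibrant and `i` is a
trivial cofibration. -/
def IsFibrantReplacement (Q W R : ObjectProperty C) {Y RY : C} (i : Y ⟶ RY) : Prop :=
  R RY ∧ trivialCofibrations Q W i

end Abelian

section Complexes

variable {A : Type u} [Category.{v} A] [Abelian A]

/-- The `n`-th suspension `Σⁿ K` of a chain complex: `(Σⁿ K)ₖ = Kₖ₋ₙ`, with differential
`(-1)ⁿ d`. -/
def suspension (n : ℤ) (K : ChainComplex A ℤ) : ChainComplex A ℤ where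
  X k := K.X (k - n)
  d i j := n.negOnePow • K.d (i - n) (j - n)
  shape i j hij := by
    have h : ¬ (ComplexShape.down ℤ).Rel (i - n) (j - n) := by
      simp only [ComplexShape.down_Rel] at hij ⊢
      omega
    rw [K.shape _ _ h, smul_zero]
  d_comp_d' i j k _ _ := by
    rw [Linear.comp_units_smul, Linear.units_smul_comp, K.d_comp_d, smul_zero, smul_zero]

/-- A complex is contractible if its identity is chain homotopic to zero. -/
def IsContractible (K : ChainComplex A ℤ) : Prop :=
  Nonempty (Homotopy (𝟙 K) 0)

/-- Chain maps from `K` to `L` modulo chain homotopy. -/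
def HomotopyClasses (K L : ChainComplex A ℤ) : Type v :=
  Quot (fun f g : K ⟶ L => Nonempty (Homotopy f g))

/-- For a class `P` of complexes, the objects of the chain homotopy category that lie in `P`. -/
def homotopyObjects (P : ObjectProperty (ChainComplex A ℤ)) :
    ObjectProperty (HomotopyCategory A (ComplexShape.down ℤ)) :=
  fun X => P X.as

/-- `K(P)`: the full subcategory of the chain homotopy category `K(A)` on the complexes in `P`. -/
abbrev K (P : ObjectProperty (ChainComplex A ℤ)) : Type (max u v) :=
  (homotopyObjects P).FullSubcategory

/-- The functor from the full subcategory `P` of complexes to `K(P)` that is the identity on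
objects and sends a chain map to its homotopy class. -/
def toK (P : ObjectProperty (ChainComplex A ℤ)) : P.FullSubcategory ⥤ K P :=
  (homotopyObjects P).lift (P.ι ⋙ HomotopyCategory.quotient A (ComplexShape.down ℤ))
    (fun X => X.property)

end Complexes

end HoveyModel

/-!
A complex `K` of the core has its cone sequence `0 ⟶ K ⟶ cone (𝟙 K) ⟶ ΣK ⟶ 0` split, because `ΣK`
is in `Q` and `K` is in `W ⊓ R`; so `K` is a retract of a contractible complex. This is
`isContractible_of_extOneVanishes`.

Most of what concerns the localization holds for a Hovey triple in any abelian category `C`. Let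
`coreMaps X Y` be the subgroup of the morphisms `X ⟶ Y` that factor through the core. For `X`
cofibrant, `Y` fibrant and `L : C ⥤ D` a localization at the weak equivalences, the map
`(X ⟶ Y) ⧸ coreMaps X Y ⟶ (L.obj X ⟶ L.obj Y)` is bijective. It is well defined since the two
retractions `(1, b)` and `(1, 0)` of `Y ⟶ Y ⊞ K`, for `K` in `W`, agree in the localization
(`map_eq_of_sub_eq_comp`). For bijectivity, fix a fibrant `Z` and consider the functor `stableHom Z`
sending `X` to `(X' ⟶ Z) ⧸ coreMaps X' Z`, where `X'` is a cofibrant replacement of `X`. It inverts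
weak equivalences (`stableHom_isInvertedBy`); the essential point is that a trivial cofibration
`X ⟶ Y` is covered by a trivial cofibration from `X'` to some cofibrant replacement of `Y`
(`exists_factorization_swap`, where the snake lemma shows that the cokernel is in `W`). Hence
`stableHom Z` descends to the localization: this gives injectivity directly
(`sub_mem_coreMaps_of_map_eq`), and surjectivity by the Yoneda lemma (`map_surjective`). No calculus
of fractions and no two-out-of-three property of weak equivalences is needed.

For complexes, a chain map is null-homotopic if and only if it factors through the cone of the
identity of its source. If contractible complexes are in `W` and complexes of the core are
contractible, then from cofibrant to fibrant complexes being null-homotopic is the same as factoring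
through the core (`sub_mem_coreMaps_iff_homotopic`), and every localization functor factors through
the homotopy category (`fromHomotopyCategory`). Its restriction to `K(Q ⊓ R)` is fully faithful by
the bijection above and essentially surjective because every object has a cofibrant replacement
which in turn has a fibrant replacement.
-/

namespace HoveyModel

section Abelian

variable {C : Type u} [Category.{v} C] [Abelian C]

/-! ### Pullbacks and pushouts of short exact sequences -/

lemma shortExact_kernel {X Y : C} (p : X ⟶ Y) [Epi p] :
    (ShortComplex.mk (kernel.ι p) p (kernel.condition p)).ShortExact where
  exact := ShortComplex.exact_of_f_is_kernel _ (kernelIsKernel p)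

lemma shortExact_cokernel {X Y : C} (i : X ⟶ Y) [Mono i] :
    (ShortComplex.mk i (cokernel.π i) (cokernel.condition i)).ShortExact where
  exact := ShortComplex.exact_of_g_is_cokernel _ (cokernelIsCokernel i)

open ZeroObject in
lemma shortExact_of_iso {X Y : C} (e : X ≅ Y) :
    (ShortComplex.mk e.hom (0 : Y ⟶ 0) comp_zero).ShortExact :=
  (ShortComplex.Splitting.ofIsIsoOfIsZero _ (inferInstanceAs (IsIso e.hom))
    (isZero_zero C)).shortExact

lemma shortExact_biprod (X Y : C) :
    (ShortComplex.mk (biprod.inl : X ⟶ X ⊞ Y) biprod.snd biprod.inl_snd).ShortExact :=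
  (ShortComplex.Splitting.ofHasBinaryBiproduct X Y).shortExact

lemma shortExact_pullback {N E B M : C} {i : N ⟶ E} {p : E ⟶ B} {w : i ≫ p = 0}
    (hS : (ShortComplex.mk i p w).ShortExact) (f : M ⟶ B) :
    (ShortComplex.mk (pullback.lift (f := p) (g := f) i 0 (by rw [w, zero_comp]))
      (pullback.snd p f) (pullback.lift_snd _ _ _)).ShortExact := by
  have hi : Mono i := hS.mono_f
  have hp : Epi p := hS.epi_g
  have hm : Mono (pullback.lift (f := p) (g := f) i (0 : N ⟶ M) (by rw [w, zero_comp])) := by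
    refine @mono_of_mono _ _ _ _ _ _ (pullback.fst p f) ?_
    rwa [pullback.lift_fst]
  refine { exact := ShortComplex.exact_of_f_is_kernel _ ?_ }
  refine KernelFork.IsLimit.ofι' _ _ fun {A} (k : A ⟶ pullback p f) hk =>
    ⟨hS.exact.lift (k ≫ pullback.fst _ _) ?_, ?_⟩
  · change k ≫ pullback.snd _ _ = 0 at hk
    change (k ≫ pullback.fst _ _) ≫ p = 0
    rw [Category.assoc, pullback.condition, reassoc_of% hk, zero_comp]
  · apply pullback.hom_ext
    · rw [Category.assoc, pullback.lift_fst]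
      exact hS.exact.lift_f _ _
    · rw [Category.assoc, pullback.lift_snd, comp_zero]
      exact hk.symm

lemma shortExact_pushout {A E B M : C} {i : A ⟶ E} {p : E ⟶ B} {w : i ≫ p = 0}
    (hS : (ShortComplex.mk i p w).ShortExact) (f : A ⟶ M) :
    (ShortComplex.mk (pushout.inr i f)
      (pushout.desc (f := i) (g := f) p 0 (by rw [w, comp_zero])) (pushout.inr_desc _ _ _)
      ).ShortExact := by
  have hi : Mono i := hS.mono_f
  have hp : Epi p := hS.epi_g
  have he : Epi (pushout.desc (f := i) (g := f) p (0 : M ⟶ B) (by rw [w, comp_zero])) := by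
    refine @epi_of_epi _ _ _ _ _ (pushout.inl i f) _ ?_
    rwa [pushout.inl_desc]
  refine { exact := ShortComplex.exact_of_g_is_cokernel _ ?_ }
  refine CokernelCofork.IsColimit.ofπ' _ _ fun {A} (k : pushout i f ⟶ A) hk =>
    ⟨hS.exact.desc (pushout.inl _ _ ≫ k) ?_, ?_⟩
  · change pushout.inr _ _ ≫ k = 0 at hk
    change i ≫ (pushout.inl _ _ ≫ k) = 0
    rw [pushout.condition_assoc, hk, comp_zero]
  · apply pushout.hom_ext
    · rw [pushout.inl_desc_assoc]
      exact hS.exact.g_desc _ _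
    · rw [pushout.inr_desc_assoc, zero_comp]
      exact hk.symm

/-- The preimage `E ×_B A` of a subobject `A ⟶ B` under an epimorphism `E ⟶ B` has the same
cokernel as `A`. -/
lemma shortExact_pullback_fst {E A B D : C} (p : E ⟶ B) [Epi p] {j : A ⟶ B} {g : B ⟶ D}
    {w : j ≫ g = 0} (hS : (ShortComplex.mk j g w).ShortExact) :
    (ShortComplex.mk (pullback.fst p j) (p ≫ g)
      (by rw [pullback.condition_assoc, w, comp_zero])).ShortExact := by
  have hj : Mono j := hS.mono_f
  have hg : Epi g := hS.epi_g
  have : Epi (p ≫ g) := inferInstance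
  refine { exact := ShortComplex.exact_of_f_is_kernel _ ?_ }
  refine KernelFork.IsLimit.ofι' _ _ fun {T} (k : T ⟶ E) hk => ?_
  change k ≫ p ≫ g = 0 at hk
  have hk' : (k ≫ p) ≫ g = 0 := by rw [Category.assoc, hk]
  exact ⟨pullback.lift k (hS.exact.lift (k ≫ p) hk') (hS.exact.lift_f _ _).symm,
    pullback.lift_fst _ _ _⟩

/-- The pushout `E / A` of a quotient `B ⟶ D` along a monomorphism `B ⟶ E`, where `D = B / A`,
has the same kernel `A`. -/
lemma shortExact_pushout_inl {E A B D : C} (i : B ⟶ E) [Mono i] {j : A ⟶ B} {g : B ⟶ D}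
    {w : j ≫ g = 0} (hS : (ShortComplex.mk j g w).ShortExact) :
    (ShortComplex.mk (j ≫ i) (pushout.inl i g)
      (by rw [Category.assoc, pushout.condition, reassoc_of% w, zero_comp])).ShortExact := by
  have hj : Mono j := hS.mono_f
  have hg : Epi g := hS.epi_g
  have : Mono (j ≫ i) := inferInstance
  refine { exact := ShortComplex.exact_of_g_is_cokernel _ ?_ }
  refine CokernelCofork.IsColimit.ofπ' _ _ fun {T} (k : E ⟶ T) hk => ?_
  change (j ≫ i) ≫ k = 0 at hk
  have hk' : j ≫ i ≫ k = 0 := by rw [← Category.assoc, hk]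
  exact ⟨pushout.desc k (hS.exact.desc (i ≫ k) hk') (hS.exact.g_desc _ _).symm,
    pushout.inl_desc _ _ _⟩

/-! ### Vanishing of `Ext¹` -/

namespace ExtOneVanishes

/-- If `Ext¹(M, N)` vanishes, morphisms from `M` lift along epimorphisms with kernel `N`. -/
lemma exists_lift {M N : C} (h : ExtOneVanishes M N) {E B : C} {i : N ⟶ E} {p : E ⟶ B}
    {w : i ≫ p = 0} (hS : (ShortComplex.mk i p w).ShortExact) (f : M ⟶ B) :
    ∃ g : M ⟶ E, g ≫ p = f := by
  obtain ⟨s⟩ := h _ _ _ (shortExact_pullback hS f)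
  have hs : s.s ≫ pullback.snd p f = 𝟙 M := s.s_g
  exact ⟨s.s ≫ pullback.fst p f, by
    rw [Category.assoc, pullback.condition, reassoc_of% hs]⟩

/-- If `Ext¹(M, N)` vanishes, morphisms to `N` extend along monomorphisms with cokernel `M`. -/
lemma exists_extension {M N : C} (h : ExtOneVanishes M N) {A B : C} {i : A ⟶ B} {p : B ⟶ M}
    {w : i ≫ p = 0} (hS : (ShortComplex.mk i p w).ShortExact) (f : A ⟶ N) :
    ∃ g : B ⟶ N, i ≫ g = f := by
  obtain ⟨s⟩ := h _ _ _ (shortExact_pushout hS f)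
  have hs : pushout.inr i f ≫ s.r = 𝟙 N := s.f_r
  exact ⟨pushout.inl i f ≫ s.r, by
    rw [pushout.condition_assoc, hs, Category.comp_id]⟩

lemma of_shortExact_left {A B D N : C} {j : A ⟶ B} {g : B ⟶ D} {w : j ≫ g = 0}
    (hS : (ShortComplex.mk j g w).ShortExact) (hA : ExtOneVanishes A N)
    (hD : ExtOneVanishes D N) : ExtOneVanishes B N := by
  intro E i p w' hE
  have hi : Mono i := hE.mono_f
  have hp : Epi p := hE.epi_g
  -- a retraction over the preimage of `A` exists, and it extends to all of `E`
  obtain ⟨s⟩ := hA _ _ _ (shortExact_pullback hE j)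
  obtain ⟨r, hr⟩ := hD.exists_extension (shortExact_pullback_fst p hS) s.r
  refine ⟨.ofExactOfRetraction _ hE.exact r ?_ hp⟩
  have h1 := s.f_r
  change pullback.lift i 0 _ ≫ s.r = 𝟙 N at h1
  rwa [← hr, pullback.lift_fst_assoc] at h1

lemma of_shortExact_right {A B D M : C} {j : A ⟶ B} {g : B ⟶ D} {w : j ≫ g = 0}
    (hS : (ShortComplex.mk j g w).ShortExact) (hA : ExtOneVanishes M A)
    (hD : ExtOneVanishes M D) : ExtOneVanishes M B := by
  intro E i p w' hE
  have hi : Mono i := hE.mono_f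
  have hp : Epi p := hE.epi_g
  -- a section modulo `A` exists, and it lifts to `E`
  obtain ⟨s⟩ := hD _ _ _ (shortExact_pushout hE g)
  obtain ⟨t, ht⟩ := hA.exists_lift (shortExact_pushout_inl i hS) s.s
  refine ⟨.ofExactOfSection _ hE.exact t ?_ hi⟩
  have h1 := s.s_g
  change s.s ≫ pushout.desc p 0 _ = 𝟙 M at h1
  rwa [← ht, Category.assoc, pushout.inl_desc] at h1

lemma of_isZero_left {M : C} (hM : IsZero M) (N : C) : ExtOneVanishes M N :=
  fun _ _ _ _ hE => ⟨.ofExactOfSection _ hE.exact 0 (hM.eq_of_src _ _) hE.mono_f⟩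

lemma of_isZero_right (M : C) {N : C} (hN : IsZero N) : ExtOneVanishes M N :=
  fun _ _ _ _ hE => ⟨.ofExactOfRetraction _ hE.exact 0 (hN.eq_of_src _ _) hE.epi_g⟩

end ExtOneVanishes

namespace IsCotorsionPair

variable {X Y : ObjectProperty C}

lemma vanishes (h : IsCotorsionPair X Y) {M N : C} (hM : X M) (hN : Y N) :
    ExtOneVanishes M N :=
  (h.left_iff M).1 hM N hN

lemma left_of_shortExact (h : IsCotorsionPair X Y) {S : ShortComplex C} (hS : S.ShortExact)
    (h₁ : X S.X₁) (h₃ : X S.X₃) :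
    X S.X₂ :=
  (h.left_iff _).2 fun _ hN => .of_shortExact_left hS (h.vanishes h₁ hN) (h.vanishes h₃ hN)

lemma right_of_shortExact (h : IsCotorsionPair X Y) {S : ShortComplex C} (hS : S.ShortExact)
    (h₁ : Y S.X₁) (h₃ : Y S.X₃) :
    Y S.X₂ :=
  (h.right_iff _).2 fun _ hM => .of_shortExact_right hS (h.vanishes hM h₁) (h.vanishes hM h₃)

lemma left_of_isZero (h : IsCotorsionPair X Y) {M : C} (hM : IsZero M) : X M :=
  (h.left_iff _).2 fun _ _ => .of_isZero_left hM _

lemma right_of_isZero (h : IsCotorsionPair X Y) {M : C} (hM : IsZero M) : Y M :=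
  (h.right_iff _).2 fun _ _ => .of_isZero_right _ hM

lemma left_of_iso (h : IsCotorsionPair X Y) {M M' : C} (e : M ≅ M') (hM : X M) : X M' :=
  h.left_of_shortExact (S := ShortComplex.mk e.hom 0 comp_zero)
    (shortExact_of_iso e) hM (h.left_of_isZero (isZero_zero C))

lemma right_of_iso (h : IsCotorsionPair X Y) {M M' : C} (e : M ≅ M') (hM : Y M) : Y M' :=
  h.right_of_shortExact (S := ShortComplex.mk e.hom 0 comp_zero)
    (shortExact_of_iso e) hM (h.right_of_isZero (isZero_zero C))

end IsCotorsionPair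

/-! ### Thick classes -/

namespace IsThick

variable {W : ObjectProperty C}

lemma of_iso (hW : IsThick W) {M N : C} (e : M ≅ N) (hM : W M) : W N :=
  hW.of_retract e.symm.retract hM

/-- For an epimorphism of short exact sequences, the snake lemma gives a short exact sequence of
kernels; so membership in `W` of the first two kernels passes to the third one. -/
lemma of_epi_of_kernels (hW : IsThick W) {S₁ S₂ : ShortComplex C} (h₁ : S₁.ShortExact)
    (h₂ : S₂.ShortExact) (φ : S₁ ⟶ S₂) [Epi φ.τ₁] [Epi φ.τ₂] (hk₁ : W (kernel φ.τ₁))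
    (hk₂ : W (kernel φ.τ₂)) (h : W S₂.X₃) : W S₁.X₃ := by
  have := h₁.mono_f
  have := h₁.epi_g
  have := h₂.mono_f
  have := h₂.epi_g
  let S : ShortComplex.SnakeInput C :=
    { L₀ := kernel φ
      L₁ := S₁
      L₂ := S₂
      L₃ := cokernel φ
      v₀₁ := kernel.ι φ
      v₁₂ := φ
      v₂₃ := cokernel.π φ
      h₀ := kernelIsKernel φ
      h₃ := cokernelIsCokernel φ
      L₁_exact := h₁.exact
      epi_L₁_g := inferInstance
      L₂_exact := h₂.exact
      mono_L₂_f := inferInstance }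
  have : Epi φ.τ₃ := by
    have : Epi (S₁.g ≫ φ.τ₃) := by rw [← φ.comm₂₃]; infer_instance
    exact epi_of_epi S₁.g φ.τ₃
  have : Mono S.L₁.f := inferInstanceAs (Mono S₁.f)
  have := S.epi_v₂₃_τ₁
  have hz : IsZero S.L₃.X₁ := by
    have h0 : φ.τ₁ ≫ S.v₂₃.τ₁ = 0 := S.w₁₃_τ₁
    rw [IsZero.iff_id_eq_zero, ← cancel_epi S.v₂₃.τ₁, ← cancel_epi φ.τ₁, reassoc_of% h0]
    simp
  have hg : Epi S.L₀.g := S.L₁'_exact.epi_f (hz.eq_of_tgt _ _)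
  have hL : S.L₀.ShortExact := { exact := S.L₀_exact, mono_f := S.mono_L₀_f, epi_g := hg }
  have e₁ : kernel φ.τ₁ ≅ S.L₀.X₁ := (kernelIsKernel φ.τ₁).conePointUniqueUpToIso S.h₀τ₁
  have e₂ : kernel φ.τ₂ ≅ S.L₀.X₂ := (kernelIsKernel φ.τ₂).conePointUniqueUpToIso S.h₀τ₂
  have h₃ : W S.L₀.X₃ := hW.third _ hL (hW.of_iso e₁ hk₁) (hW.of_iso e₂ hk₂)
  exact hW.second (ShortComplex.mk S.v₀₁.τ₃ φ.τ₃ S.w₀₂_τ₃)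
    { exact := S.exact_C₃_up, mono_f := S.mono_v₀₁_τ₃, epi_g := ‹_› } h₃ h

end IsThick

/-! ### Trivial fibrations and factorizations -/

namespace IsHoveyTriple

variable {Q W R : ObjectProperty C}

lemma trivialFibrations_of_shortExact (hT : IsHoveyTriple Q W R) {N E B : C} {i : N ⟶ E}
    {p : E ⟶ B} {w : i ≫ p = 0} (hS : (ShortComplex.mk i p w).ShortExact) (hN : (W ⊓ R) N) :
    trivialFibrations W R p :=
  ⟨hS.epi_g, hT.cof_trivFib.right_of_iso (hS.fIsKernel.conePointUniqueUpToIso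
    (limit.isLimit _)) hN⟩

lemma cokernel_of_shortExact (hT : IsHoveyTriple Q W R) {A E B : C} {i : A ⟶ E}
    {p : E ⟶ B} {w : i ≫ p = 0} (hS : (ShortComplex.mk i p w).ShortExact) (hB : Q B) :
    Q (cokernel i) :=
  hT.cof_trivFib.left_of_iso (hS.gIsCokernel.coconePointUniqueUpToIso (colimit.isColimit _)) hB

lemma trivialFibrations_comp (hT : IsHoveyTriple Q W R) {X Y Z : C} {p : X ⟶ Y} {q : Y ⟶ Z}
    (hp : trivialFibrations W R p) (hq : trivialFibrations W R q) :
    trivialFibrations W R (p ≫ q) := by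
  obtain ⟨_, hp⟩ := hp
  obtain ⟨_, hq⟩ := hq
  exact hT.trivialFibrations_of_shortExact (shortExact_pullback_fst p (shortExact_kernel q))
    (hT.cof_trivFib.right_of_shortExact
      (shortExact_pullback (shortExact_kernel p) (kernel.ι q)) hp hq)

lemma cokernel_comp (hT : IsHoveyTriple Q W R) {X Y Z : C} (i : X ⟶ Y) (j : Y ⟶ Z) [Mono i]
    [Mono j] (hi : Q (cokernel i)) (hj : Q (cokernel j)) : Q (cokernel (i ≫ j)) :=
  hT.cokernel_of_shortExact (shortExact_pushout_inl j (shortExact_cokernel i))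
    (hT.cof_trivFib.left_of_shortExact
      (shortExact_pushout (shortExact_cokernel j) (cokernel.π i)) hi hj)

lemma weakEquivalences_of_trivialFibrations (hT : IsHoveyTriple Q W R) {X Y : C} {p : X ⟶ Y}
    (hp : trivialFibrations W R p) : weakEquivalences Q W R p :=
  ⟨X, 𝟙 X, p, ⟨inferInstance,
    hT.trivCof_fib.left_of_isZero (isZero_cokernel_of_epi _)⟩, hp, Category.id_comp _⟩

lemma weakEquivalences_of_trivialCofibrations (hT : IsHoveyTriple Q W R) {X Y : C} {i : X ⟶ Y}
    (hi : trivialCofibrations Q W i) : weakEquivalences Q W R i :=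
  ⟨Y, i, 𝟙 Y, hi, ⟨inferInstance,
    hT.cof_trivFib.right_of_isZero (isZero_kernel_of_mono _)⟩, Category.comp_id _⟩

lemma exists_cofibrantReplacement (hT : IsHoveyTriple Q W R) (X : C) :
    ∃ (QX : C) (p : QX ⟶ X), IsCofibrantReplacement Q W R p := by
  obtain ⟨N, L, i, p, w, hL, hN, hS⟩ := hT.cof_trivFib.enough_left X
  exact ⟨L, p, hL, hT.trivialFibrations_of_shortExact hS hN⟩

lemma exists_fibrantReplacement (hT : IsHoveyTriple Q W R) (Y : C) :
    ∃ (RY : C) (i : Y ⟶ RY), IsFibrantReplacement Q W R i := by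
  obtain ⟨N, L, i, p, w, hL, hN, hS⟩ := hT.trivCof_fib.enough_right Y
  exact ⟨N, i, hN, hS.mono_f, hT.trivCof_fib.left_of_iso
    (hS.gIsCokernel.coconePointUniqueUpToIso (colimit.isColimit _)) hL⟩

lemma exists_lift (hT : IsHoveyTriple Q W R) {M E B : C} (hM : Q M) {p : E ⟶ B}
    (hp : trivialFibrations W R p) (f : M ⟶ B) : ∃ g : M ⟶ E, g ≫ p = f := by
  obtain ⟨_, hp⟩ := hp
  exact (hT.cof_trivFib.vanishes hM hp).exists_lift (shortExact_kernel p) f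

lemma exists_extension (hT : IsHoveyTriple Q W R) {A B N : C} (hN : R N) {i : A ⟶ B}
    (hi : trivialCofibrations Q W i) (f : A ⟶ N) : ∃ g : B ⟶ N, i ≫ g = f := by
  obtain ⟨_, hi⟩ := hi
  exact (hT.trivCof_fib.vanishes hi hN).exists_extension (shortExact_cokernel i) f

/-- Every morphism is a cofibration (a monomorphism with cokernel in `Q`) followed by a trivial
fibration. -/
lemma exists_factorization (hT : IsHoveyTriple Q W R) {A B : C} (f : A ⟶ B) :
    ∃ (Z : C) (j : A ⟶ Z) (q : Z ⟶ B), Mono j ∧ Q (cokernel j) ∧ trivialFibrations W R q ∧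
      j ≫ q = f := by
  -- `A ⊞ L ⟶ B` is an epimorphism; its kernel `K` is embedded into an object of `W ⊓ R`
  obtain ⟨L, π, hL, ⟨_, -⟩⟩ := hT.exists_cofibrantReplacement B
  have : Epi (biprod.desc f π) := by
    refine @epi_of_epi _ _ _ _ _ biprod.inr _ ?_
    rwa [biprod.inr_desc]
  obtain ⟨N, L', k, s, w, hL', hN, hS⟩ :=
    hT.cof_trivFib.enough_right (kernel (biprod.desc f π))
  let ι := kernel.ι (biprod.desc f π)
  have hB := shortExact_pushout (shortExact_kernel (biprod.desc f π)) k
  have hS' := shortExact_pushout hS ι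
  have hj : Mono (pushout.inl ι k) := by
    have : Mono (pushout.inr k ι) := hS'.mono_f
    have e : pushout.inl ι k = pushout.inr k ι ≫ (pushoutSymmetry k ι).hom := by simp
    rw [e]
    infer_instance
  have hQ : Q (cokernel (pushout.inl ι k)) := by
    have e : pushout.inr k ι = pushout.inl ι k ≫ (pushoutSymmetry ι k).hom := by simp
    have h := hT.cokernel_of_shortExact hS' hL'
    rw [e] at h
    exact hT.cof_trivFib.left_of_iso (cokernelCompIsIso _ _) h
  refine ⟨pushout ι k, biprod.inl ≫ pushout.inl ι k, _, inferInstance,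
    hT.cokernel_comp _ _ (hT.cokernel_of_shortExact (shortExact_biprod A L) hL) hQ,
    hT.trivialFibrations_of_shortExact hB hN, ?_⟩
  change (biprod.inl ≫ pushout.inl _ _) ≫ pushout.desc (biprod.desc f π) 0 _ = f
  rw [Category.assoc, pushout.inl_desc, biprod.inl_desc]

/-- A trivial fibration followed by a trivial cofibration, starting from a cofibrant object, can be
rewritten in the opposite order, with a cofibrant object in the middle. -/
lemma exists_factorization_swap (hT : IsHoveyTriple Q W R) {X' X Y : C} (hX' : Q X') {p : X' ⟶ X}
    (hp : trivialFibrations W R p) {i : X ⟶ Y} (hi : trivialCofibrations Q W i) :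
    ∃ (Z : C) (j : X' ⟶ Z) (q : Z ⟶ Y), Q Z ∧ trivialCofibrations Q W j ∧
      trivialFibrations W R q ∧ j ≫ q = p ≫ i := by
  obtain ⟨Z, j, q, hj, hQ, hq, fac⟩ := hT.exists_factorization (p ≫ i)
  refine ⟨Z, j, q, hT.cof_trivFib.left_of_shortExact (shortExact_cokernel j) hX' hQ,
    ⟨hj, hQ, ?_⟩, hq, fac⟩
  obtain ⟨_, hi⟩ := hi
  obtain ⟨_, hp⟩ := hp
  obtain ⟨_, hq⟩ := hq
  let φ : ShortComplex.mk j (cokernel.π j) (cokernel.condition j) ⟶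
      ShortComplex.mk i (cokernel.π i) (cokernel.condition i) :=
    { τ₁ := p
      τ₂ := q
      τ₃ := cokernel.map j i p q fac }
  have : Epi φ.τ₁ := ‹Epi p›
  have : Epi φ.τ₂ := ‹Epi q›
  exact hT.thick.of_epi_of_kernels (shortExact_cokernel j) (shortExact_cokernel i) φ
    hp.1 hq.1 hi.2

/-! ### Morphisms that factor through the core -/

lemma core_biprod (hT : IsHoveyTriple Q W R) {M N : C} (hM : core Q W R M) (hN : core Q W R N) :
    core Q W R (M ⊞ N) :=
  ⟨hT.trivCof_fib.left_of_shortExact (shortExact_biprod M N) hM.1 hN.1,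
    hT.trivCof_fib.right_of_shortExact (shortExact_biprod M N) hM.2 hN.2⟩

/-- The subgroup of the morphisms that factor through an object of the core. -/
def coreMaps (hT : IsHoveyTriple Q W R) (X Y : C) : AddSubgroup (X ⟶ Y) where
  carrier := {f | ∃ (M : C) (a : X ⟶ M) (b : M ⟶ Y), core Q W R M ∧ a ≫ b = f}
  zero_mem' := ⟨_, 0, 0, ⟨hT.trivCof_fib.left_of_isZero (isZero_kernel_of_mono (𝟙 X)),
    hT.trivCof_fib.right_of_isZero (isZero_kernel_of_mono (𝟙 X))⟩, comp_zero⟩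
  add_mem' := by
    rintro _ _ ⟨M, a, b, hM, rfl⟩ ⟨N, c, d, hN, rfl⟩
    exact ⟨M ⊞ N, biprod.lift a c, biprod.desc b d, hT.core_biprod hM hN, by simp⟩
  neg_mem' := by
    rintro _ ⟨M, a, b, hM, rfl⟩
    exact ⟨M, -a, b, hM, by simp⟩

lemma comp_mem_coreMaps (hT : IsHoveyTriple Q W R) {X Y Z : C} (g : X ⟶ Y) {f : Y ⟶ Z}
    (hf : f ∈ hT.coreMaps Y Z) : g ≫ f ∈ hT.coreMaps X Z := by
  obtain ⟨M, a, b, hM, rfl⟩ := hf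
  exact ⟨M, g ≫ a, b, hM, by simp⟩

/-- A map from a cofibrant object `X` to an object `N` of `W ⊓ R` lifts to a cofibrant replacement
of `N`, which is in the core. -/
lemma comp_mem_coreMaps_of_left (hT : IsHoveyTriple Q W R) {X N Y : C} (hX : Q X)
    (hN : (W ⊓ R) N) (a : X ⟶ N) (b : N ⟶ Y) : a ≫ b ∈ hT.coreMaps X Y := by
  obtain ⟨K, L, i, p, w, hL, hK, hS⟩ := hT.cof_trivFib.enough_left N
  obtain ⟨c, rfl⟩ := hT.exists_lift hX (hT.trivialFibrations_of_shortExact hS hK) a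
  have h := hT.cof_trivFib.right_of_shortExact hS hK hN
  exact ⟨L, c, p ≫ b, ⟨⟨hL, h.1⟩, h.2⟩, by simp⟩

/-- A map from an object `T` of `Q ⊓ W` to a fibrant object `Y` extends to a fibrant replacement
of `T`, which is in the core. -/
lemma comp_mem_coreMaps_of_right (hT : IsHoveyTriple Q W R) {X T Y : C} (hT' : (Q ⊓ W) T)
    (hY : R Y) (a : X ⟶ T) (b : T ⟶ Y) : a ≫ b ∈ hT.coreMaps X Y := by
  obtain ⟨N, L, i, p, w, hL, hN, hS⟩ := hT.trivCof_fib.enough_right T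
  obtain ⟨c, rfl⟩ := (hT.trivCof_fib.vanishes hL hY).exists_extension hS b
  exact ⟨N, a ≫ i, c, ⟨hT.trivCof_fib.left_of_shortExact hS hT' hL, hN⟩, by simp⟩

/-- From a cofibrant to a fibrant object, factoring through an object of `W` is the same as
factoring through the core. -/
lemma comp_mem_coreMaps_of_W (hT : IsHoveyTriple Q W R) {X K Y : C} (hX : Q X) (hK : W K)
    (hY : R Y) (a : X ⟶ K) (b : K ⟶ Y) : a ≫ b ∈ hT.coreMaps X Y := by
  obtain ⟨N, L, i, p, w, hL, hN, hS⟩ := hT.trivCof_fib.enough_right K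
  obtain ⟨c, rfl⟩ := (hT.trivCof_fib.vanishes hL hY).exists_extension hS b
  rw [← Category.assoc]
  exact hT.comp_mem_coreMaps_of_left hX ⟨hT.thick.second _ hS hK hL.2, hN⟩ _ _

/-- Two morphisms from a cofibrant object that agree after a trivial fibration differ by a morphism
through the core. -/
lemma sub_comp_mem_coreMaps (hT : IsHoveyTriple Q W R) {X E B Y : C} (hX : Q X) {p : E ⟶ B}
    (hp : trivialFibrations W R p) {a b : X ⟶ E} (h : a ≫ p = b ≫ p) (f : E ⟶ Y) :
    a ≫ f - b ≫ f ∈ hT.coreMaps X Y := by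
  have h' : (a - b) ≫ p = 0 := by rw [Preadditive.sub_comp, h, sub_self]
  rw [← Preadditive.sub_comp, ← kernel.lift_ι p (a - b) h', Category.assoc]
  exact hT.comp_mem_coreMaps_of_left hX hp.2 _ _

/-- If the restriction of `f` along a trivial cofibration factors through the core, then so does
`f` itself. -/
lemma mem_coreMaps_of_comp_mem (hT : IsHoveyTriple Q W R) {X Z Y : C} (hY : R Y) {j : X ⟶ Z}
    (hj : trivialCofibrations Q W j) {f : Z ⟶ Y} (hf : j ≫ f ∈ hT.coreMaps X Y) :
    f ∈ hT.coreMaps Z Y := by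
  obtain ⟨M, a, b, hM, fac⟩ := hf
  obtain ⟨c, rfl⟩ := hT.exists_extension hM.2 hj a
  have h : j ≫ (f - c ≫ b) = 0 := by
    rw [Preadditive.comp_sub, ← fac, Category.assoc, sub_self]
  have h' := hT.comp_mem_coreMaps_of_right hj.2 hY (cokernel.π j) (cokernel.desc j _ h)
  rw [cokernel.π_desc] at h'
  have := (hT.coreMaps Z Y).add_mem h' ⟨M, c, b, hM, rfl⟩
  rwa [sub_add_cancel] at this

/-! ### Morphisms modulo the core as a functor -/

/-- Precomposition with `a` on groups of morphisms modulo those that factor through the core. -/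
def precomp (hT : IsHoveyTriple Q W R) {X Y : C} (a : X ⟶ Y) (Z : C) :
    (Y ⟶ Z) ⧸ hT.coreMaps Y Z →+ (X ⟶ Z) ⧸ hT.coreMaps X Z :=
  QuotientAddGroup.map _ _ (Preadditive.leftComp Z a) fun _ hf => hT.comp_mem_coreMaps a hf

lemma precomp_mk (hT : IsHoveyTriple Q W R) {X Y Z : C} (a : X ⟶ Y) (f : Y ⟶ Z) :
    hT.precomp a Z (QuotientAddGroup.mk f) = QuotientAddGroup.mk (a ≫ f) := rfl

lemma precomp_id_apply (hT : IsHoveyTriple Q W R) {X Z : C} (x : (X ⟶ Z) ⧸ hT.coreMaps X Z) :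
    hT.precomp (𝟙 X) Z x = x := by
  obtain ⟨f, rfl⟩ := QuotientAddGroup.mk_surjective x
  rw [precomp_mk, Category.id_comp]

lemma precomp_comp_apply (hT : IsHoveyTriple Q W R) {X Y T Z : C} (a : X ⟶ Y) (b : Y ⟶ T)
    (x : (T ⟶ Z) ⧸ hT.coreMaps T Z) :
    hT.precomp (a ≫ b) Z x = hT.precomp a Z (hT.precomp b Z x) := by
  obtain ⟨f, rfl⟩ := QuotientAddGroup.mk_surjective x
  simp only [precomp_mk, Category.assoc]

lemma precomp_eq (hT : IsHoveyTriple Q W R) {X E B : C} (hX : Q X) {p : E ⟶ B}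
    (hp : trivialFibrations W R p) {a b : X ⟶ E} (h : a ≫ p = b ≫ p) (Z : C) :
    hT.precomp a Z = hT.precomp b Z := by
  ext x
  exact (QuotientAddGroup.eq_iff_sub_mem).2 (hT.sub_comp_mem_coreMaps hX hp h x)

lemma precomp_bijective_of_trivialCofibrations (hT : IsHoveyTriple Q W R) {X Y Z : C} (hZ : R Z)
    {j : X ⟶ Y} (hj : trivialCofibrations Q W j) : Function.Bijective (hT.precomp j Z) := by
  refine ⟨(injective_iff_map_eq_zero _).2 fun x hx => ?_, fun y => ?_⟩
  · obtain ⟨f, rfl⟩ := QuotientAddGroup.mk_surjective x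
    rw [precomp_mk, QuotientAddGroup.eq_zero_iff] at hx
    exact (QuotientAddGroup.eq_zero_iff _).2 (hT.mem_coreMaps_of_comp_mem hZ hj hx)
  · obtain ⟨f, rfl⟩ := QuotientAddGroup.mk_surjective y
    obtain ⟨g, rfl⟩ := hT.exists_extension hZ hj f
    exact ⟨QuotientAddGroup.mk g, rfl⟩

/-- A morphism between two cofibrant replacements of the same object is invertible modulo the
core. -/
lemma precomp_bijective_of_comp_eq (hT : IsHoveyTriple Q W R) {X X' Y : C} {p : X ⟶ Y}
    {p' : X' ⟶ Y} (hp : IsCofibrantReplacement Q W R p) (hp' : IsCofibrantReplacement Q W R p')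
    (a : X ⟶ X') (ha : a ≫ p' = p) (Z : C) : Function.Bijective (hT.precomp a Z) := by
  obtain ⟨b, hb⟩ := hT.exists_lift hp'.1 hp.2 p'
  refine Function.bijective_iff_has_inverse.2 ⟨hT.precomp b Z, fun x => ?_, fun x => ?_⟩
  · rw [← precomp_comp_apply, hT.precomp_eq (b := 𝟙 _) hp'.1 hp'.2 (by simp [ha, hb]),
      precomp_id_apply]
  · rw [← precomp_comp_apply, hT.precomp_eq (b := 𝟙 _) hp.1 hp.2 (by simp [ha, hb]),
      precomp_id_apply]

/-- A chosen cofibrant replacement of `X`. -/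
noncomputable def cofRep (hT : IsHoveyTriple Q W R) (X : C) : C :=
  (hT.exists_cofibrantReplacement X).choose

/-- The trivial fibration from the chosen cofibrant replacement. -/
noncomputable def cofRepMap (hT : IsHoveyTriple Q W R) (X : C) : hT.cofRep X ⟶ X :=
  (hT.exists_cofibrantReplacement X).choose_spec.choose

lemma isCofibrantReplacement_cofRepMap (hT : IsHoveyTriple Q W R) (X : C) :
    IsCofibrantReplacement Q W R (hT.cofRepMap X) :=
  (hT.exists_cofibrantReplacement X).choose_spec.choose_spec

/-- A chosen lift of `f` to the cofibrant replacements. -/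
noncomputable def cofLift (hT : IsHoveyTriple Q W R) {X Y : C} (f : X ⟶ Y) :
    hT.cofRep X ⟶ hT.cofRep Y :=
  (hT.exists_lift (hT.isCofibrantReplacement_cofRepMap X).1
    (hT.isCofibrantReplacement_cofRepMap Y).2 (hT.cofRepMap X ≫ f)).choose

@[simp]
lemma cofLift_comp_cofRepMap (hT : IsHoveyTriple Q W R) {X Y : C} (f : X ⟶ Y) :
    hT.cofLift f ≫ hT.cofRepMap Y = hT.cofRepMap X ≫ f :=
  (hT.exists_lift (hT.isCofibrantReplacement_cofRepMap X).1
    (hT.isCofibrantReplacement_cofRepMap Y).2 (hT.cofRepMap X ≫ f)).choose_spec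

/-- The contravariant functor that sends `X` to the group of morphisms from a cofibrant replacement
of `X` to `Z`, modulo those that factor through the core. Universe lifting makes it comparable
with the morphisms of a localization. -/
noncomputable def stableHom (hT : IsHoveyTriple Q W R) (Z : C) : Cᵒᵖ ⥤ Type (max v v') where
  obj X := ULift.{v'} ((hT.cofRep X.unop ⟶ Z) ⧸ hT.coreMaps (hT.cofRep X.unop) Z)
  map f := TypeCat.ofHom fun x => ⟨hT.precomp (hT.cofLift f.unop) Z x.down⟩
  map_id X := by
    ext x
    have h := hT.isCofibrantReplacement_cofRepMap X.unop
    exact (DFunLike.congr_fun (hT.precomp_eq (b := 𝟙 _) h.1 h.2 (by simp) Z) x.down).trans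
      (hT.precomp_id_apply _)
  map_comp {X Y T} f g := by
    ext x
    exact (DFunLike.congr_fun (hT.precomp_eq (b := hT.cofLift g.unop ≫ hT.cofLift f.unop)
      (hT.isCofibrantReplacement_cofRepMap T.unop).1
      (hT.isCofibrantReplacement_cofRepMap X.unop).2
      (by simp [reassoc_of% (hT.cofLift_comp_cofRepMap g.unop)]) Z) x.down).trans
      (hT.precomp_comp_apply _ _ _)

/-- The chosen lift of `f : X ⟶ Y` may be replaced by a lift `j` to any other cofibrant replacement
of `Y`. -/
lemma precomp_cofLift_bijective (hT : IsHoveyTriple Q W R) {X Y T Z : C} (f : X ⟶ Y)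
    {q : T ⟶ Y} (hq : IsCofibrantReplacement Q W R q) (j : hT.cofRep X ⟶ T)
    (hj : j ≫ q = hT.cofRepMap X ≫ f) (hj' : Function.Bijective (hT.precomp j Z)) :
    Function.Bijective (hT.precomp (hT.cofLift f) Z) := by
  have hY := hT.isCofibrantReplacement_cofRepMap Y
  obtain ⟨k, hk⟩ := hT.exists_lift hY.1 hq.2 (hT.cofRepMap Y)
  have hk' := hT.precomp_bijective_of_comp_eq hY hq k hk Z
  have e : hT.precomp j Z = hT.precomp (hT.cofLift f ≫ k) Z :=
    hT.precomp_eq (hT.isCofibrantReplacement_cofRepMap X).1 hq.2 (by simp [hj, hk]) Z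
  have e' : (hT.precomp j Z : _ → _) = hT.precomp (hT.cofLift f) Z ∘ hT.precomp k Z := by
    rw [e]
    exact funext (hT.precomp_comp_apply _ _)
  rw [e'] at hj'
  exact (Function.Bijective.of_comp_iff _ hk').1 hj'

/-- Trivial fibrations are inverted because they turn cofibrant replacements into cofibrant
replacements. Trivial cofibrations are inverted because maps to the fibrant object `Z` extend along
them, once they are covered by trivial cofibrations of cofibrant objects. -/
lemma stableHom_isInvertedBy (hT : IsHoveyTriple Q W R) {Z : C} (hZ : R Z) :
    (weakEquivalences Q W R).op.IsInvertedBy (hT.stableHom.{u, v, v'} Z) := by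
  have key : ∀ {X Y : C} (f : X ⟶ Y), Function.Bijective (hT.precomp (hT.cofLift f) Z) →
      IsIso ((hT.stableHom.{u, v, v'} Z).map f.op) := by
    intro X Y f hf
    rw [isIso_iff_bijective]
    exact (Equiv.ulift.symm.bijective.comp hf).comp Equiv.ulift.bijective
  rintro ⟨Y⟩ ⟨X⟩ f ⟨T, i, p, hi, hp, fac⟩
  have e : f = p.op ≫ i.op := by rw [← op_comp, fac]; rfl
  rw [e, Functor.map_comp]
  have h₁ : IsIso ((hT.stableHom.{u, v, v'} Z).map i.op) := by
    have hX := hT.isCofibrantReplacement_cofRepMap X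
    obtain ⟨S, j, q, hS, hj, hq, h⟩ := hT.exists_factorization_swap hX.1 hX.2 hi
    exact key i (hT.precomp_cofLift_bijective i ⟨hS, hq⟩ j h
      (hT.precomp_bijective_of_trivialCofibrations hZ hj))
  have h₂ : IsIso ((hT.stableHom.{u, v, v'} Z).map p.op) := by
    have hT' := hT.isCofibrantReplacement_cofRepMap T
    refine key p (hT.precomp_cofLift_bijective p ⟨hT'.1, hT.trivialFibrations_comp hT'.2 hp⟩
      (𝟙 _) (Category.id_comp _) ?_)
    exact hT.precomp_bijective_of_comp_eq hT' hT' _ (Category.id_comp _) Z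
  exact IsIso.comp_isIso

/-! ### Morphisms in the localization -/

section Localization

variable {D : Type u'} [Category.{v'} D] (L : C ⥤ D) [L.IsLocalization (weakEquivalences Q W R)]

lemma isIso_map_of_trivialFibrations (hT : IsHoveyTriple Q W R) {X Y : C} {p : X ⟶ Y}
    (hp : trivialFibrations W R p) : IsIso (L.map p) :=
  Localization.inverts L (weakEquivalences Q W R) p (hT.weakEquivalences_of_trivialFibrations hp)

lemma isIso_map_of_trivialCofibrations (hT : IsHoveyTriple Q W R) {X Y : C} {i : X ⟶ Y}
    (hi : trivialCofibrations Q W i) : IsIso (L.map i) :=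
  Localization.inverts L (weakEquivalences Q W R) i (hT.weakEquivalences_of_trivialCofibrations hi)

/-- The inclusion of `Y` into its sum with an object `K` of `W` becomes invertible. -/
lemma isIso_map_biprod_inl (hT : IsHoveyTriple Q W R) (Y : C) {K : C} (hK : W K) :
    IsIso (L.map (biprod.inl : Y ⟶ Y ⊞ K)) := by
  -- with `K' ⟶ K` a cofibrant replacement, factor through `Y ⊞ K'`
  obtain ⟨N, K', i, p, w, hK', hN, hS⟩ := hT.cof_trivFib.enough_left K
  have h₁ : trivialCofibrations Q W (biprod.inl : Y ⟶ Y ⊞ K') :=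
    ⟨inferInstance, hT.trivCof_fib.left_of_iso
      ((shortExact_biprod Y K').gIsCokernel.coconePointUniqueUpToIso (colimit.isColimit _))
      ⟨hK', hT.thick.second _ hS hN.1 hK⟩⟩
  have h₂ : trivialFibrations W R (biprod.map (𝟙 Y) p) := by
    have hi : Mono i := hS.mono_f
    have hp : Epi p := hS.epi_g
    refine hT.trivialFibrations_of_shortExact (i := i ≫ biprod.inr) (p := biprod.map (𝟙 Y) p)
      (w := by simp [reassoc_of% w]) ?_ hN
    refine { exact := ShortComplex.exact_of_f_is_kernel _ ?_,
             epi_g := inferInstanceAs (Epi (biprod.map (𝟙 Y) p)),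
             mono_f := inferInstanceAs (Mono (i ≫ biprod.inr)) }
    refine KernelFork.IsLimit.ofι' _ _ fun {T} (k : T ⟶ Y ⊞ K') hk => ?_
    change k ≫ biprod.map (𝟙 Y) p = 0 at hk
    have hk₁ : k ≫ biprod.fst = 0 := by
      have := hk =≫ biprod.fst
      simpa using this
    have hk₂ : (k ≫ biprod.snd) ≫ p = 0 := by
      have := hk =≫ biprod.snd
      simpa using this
    refine ⟨hS.exact.lift (k ≫ biprod.snd) hk₂, ?_⟩
    have := hS.exact.lift_f (k ≫ biprod.snd) hk₂
    apply biprod.hom_ext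
    · simp [hk₁]
    · simpa using this
  have := hT.isIso_map_of_trivialCofibrations L h₁
  have := hT.isIso_map_of_trivialFibrations L h₂
  have e : (biprod.inl : Y ⟶ Y ⊞ K) = biprod.inl ≫ biprod.map (𝟙 Y) p := by simp
  rw [e, L.map_comp]
  infer_instance

/-- Morphisms whose difference factors through an object of `W` are identified in the
localization. -/
lemma map_eq_of_sub_eq_comp (hT : IsHoveyTriple Q W R) {X K Y : C} (hK : W K) {f g : X ⟶ Y}
    (a : X ⟶ K) (b : K ⟶ Y) (h : f - g = a ≫ b) : L.map f = L.map g := by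
  have := hT.isIso_map_biprod_inl L Y hK
  -- `(1, b)` and `(1, 0)` are retractions of the same invertible inclusion
  have key : L.map (biprod.desc (𝟙 Y) b) = L.map (biprod.desc (𝟙 Y) (0 : K ⟶ Y)) := by
    rw [← cancel_epi (L.map (biprod.inl : Y ⟶ Y ⊞ K)), ← L.map_comp, ← L.map_comp,
      biprod.inl_desc, biprod.inl_desc]
  have hf : f = biprod.lift g a ≫ biprod.desc (𝟙 Y) b := by
    rw [biprod.lift_desc, Category.comp_id, ← h, add_sub_cancel]
  have hg : g = biprod.lift g a ≫ biprod.desc (𝟙 Y) 0 := by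
    rw [biprod.lift_desc, Category.comp_id, comp_zero, add_zero]
  rw [hf, L.map_comp, key, ← L.map_comp, ← hg]

lemma map_eq_of_sub_mem_coreMaps (hT : IsHoveyTriple Q W R) {X Y : C} {f g : X ⟶ Y}
    (h : f - g ∈ hT.coreMaps X Y) : L.map f = L.map g := by
  obtain ⟨K, a, b, hK, h⟩ := h
  exact hT.map_eq_of_sub_eq_comp L hK.1.2 a b h.symm

/-- Parallel morphisms from a cofibrant to a fibrant object that are identified in the localization
differ by a morphism through the core. -/
lemma sub_mem_coreMaps_of_map_eq (hT : IsHoveyTriple Q W R) {X Y : C} (hX : Q X) (hY : R Y)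
    {f g : X ⟶ Y} (h : L.map f = L.map g) : f - g ∈ hT.coreMaps X Y := by
  have hop : AreEqualizedByLocalization (weakEquivalences Q W R).op f.op g.op :=
    (areEqualizedByLocalization_iff L.op _ _ _).2 (congrArg Quiver.Hom.op h)
  have e := hop.map_eq_of_isInvertedBy _ (hT.stableHom_isInvertedBy.{u, v, v} hY)
  have e' := congrArg ULift.down (ConcreteCategory.congr_hom e
    ⟨QuotientAddGroup.mk (hT.cofRepMap Y)⟩)
  change QuotientAddGroup.mk (hT.cofLift f ≫ hT.cofRepMap Y) =
    QuotientAddGroup.mk (hT.cofLift g ≫ hT.cofRepMap Y) at e'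
  rw [cofLift_comp_cofRepMap, cofLift_comp_cofRepMap] at e'
  have e'' := (QuotientAddGroup.eq_iff_sub_mem).1 e'
  -- the cofibrant replacement of the cofibrant object `X` has a section
  obtain ⟨s, hs⟩ := hT.exists_lift hX (hT.isCofibrantReplacement_cofRepMap X).2 (𝟙 X)
  simpa only [Preadditive.comp_sub, reassoc_of% hs] using hT.comp_mem_coreMaps s e''

/-- The natural transformation that sends the class of `f : cofRep X ⟶ Z` to the morphism
`X ⟶ Z` of the localization that it represents. -/
noncomputable def stableHomToLocalization (hT : IsHoveyTriple Q W R) (Z : C) :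
    hT.stableHom.{u, v, v'} Z ⟶ L.op ⋙ yoneda.obj (L.obj Z) ⋙ uliftFunctor.{v} where
  app X := TypeCat.ofHom fun x => ⟨
    haveI := hT.isIso_map_of_trivialFibrations L (hT.isCofibrantReplacement_cofRepMap X.unop).2
    Quotient.liftOn' x.down (fun f => inv (L.map (hT.cofRepMap X.unop)) ≫ L.map f) fun f g h => by
      congr 1
      exact hT.map_eq_of_sub_mem_coreMaps L (QuotientAddGroup.eq_iff_sub_mem.1
        (QuotientAddGroup.eq.2 (QuotientAddGroup.leftRel_apply.1 h)))⟩
  naturality := by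
    rintro ⟨X⟩ ⟨Y⟩ f
    ext ⟨x⟩
    obtain ⟨g, rfl⟩ := QuotientAddGroup.mk_surjective x
    have := hT.isIso_map_of_trivialFibrations L (hT.isCofibrantReplacement_cofRepMap X).2
    have := hT.isIso_map_of_trivialFibrations L (hT.isCofibrantReplacement_cofRepMap Y).2
    apply ULift.ext
    change inv (L.map (hT.cofRepMap Y)) ≫ L.map (hT.cofLift f.unop ≫ g) =
      L.map f.unop ≫ inv (L.map (hT.cofRepMap X)) ≫ L.map g
    rw [IsIso.inv_comp_eq, ← L.map_comp_assoc, ← cofLift_comp_cofRepMap, L.map_comp, L.map_comp,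
      Category.assoc, IsIso.hom_inv_id_assoc]

/-- Every morphism of the localization from a cofibrant to a fibrant object comes from a morphism
of the original category. -/
lemma map_surjective (hT : IsHoveyTriple Q W R) {X Y : C} (hX : Q X) (hY : R Y)
    (g : L.obj X ⟶ L.obj Y) : ∃ f : X ⟶ Y, L.map f = g := by
  -- Both functors descend to `D`. The class `u` of the cofibrant replacement of `Y` is sent to the
  -- identity, so by naturality its image `F'.map g.op u'` is sent to `g`.
  let F := hT.stableHom.{u, v, v'} Y
  let G := yoneda.obj (L.obj Y) ⋙ uliftFunctor.{v}
  let F' := Localization.lift F (hT.stableHom_isInvertedBy hY) L.op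
  let e := Localization.fac F (hT.stableHom_isInvertedBy hY) L.op
  let τ := hT.stableHomToLocalization L Y
  let τ' : F' ⟶ G := Localization.liftNatTrans L.op (weakEquivalences Q W R).op F (L.op ⋙ G) F' G τ
  have hτ (T : C) (x : F'.obj (Opposite.op (L.obj T))) :
      τ'.app (Opposite.op (L.obj T)) x = τ.app (Opposite.op T) (e.hom.app (Opposite.op T) x) := by
    have h := ConcreteCategory.congr_hom (Localization.liftNatTrans_app L.op
      (weakEquivalences Q W R).op F (L.op ⋙ G) F' G τ (Opposite.op T)) x
    exact h
  let u : F.obj (Opposite.op Y) := ⟨QuotientAddGroup.mk (hT.cofRepMap Y)⟩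
  let u' : F'.obj (Opposite.op (L.obj Y)) := e.inv.app (Opposite.op Y) u
  have hu : τ'.app (Opposite.op (L.obj Y)) u' = ⟨𝟙 (L.obj Y)⟩ := by
    rw [hτ]
    have h : e.hom.app (Opposite.op Y) u' = u :=
      ConcreteCategory.congr_hom (e.inv_hom_id_app (Opposite.op Y)) u
    rw [h]
    have := hT.isIso_map_of_trivialFibrations L (hT.isCofibrantReplacement_cofRepMap Y).2
    apply ULift.ext
    exact IsIso.inv_hom_id (L.map (hT.cofRepMap Y))
  have hg := ConcreteCategory.congr_hom (τ'.naturality g.op) u'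
  change τ'.app (Opposite.op (L.obj X)) (F'.map g.op u') =
    G.map g.op (τ'.app (Opposite.op (L.obj Y)) u') at hg
  rw [hτ, hu] at hg
  obtain ⟨f, hf⟩ := QuotientAddGroup.mk_surjective
    (e.hom.app (Opposite.op X) (F'.map g.op u')).down
  have hf' : e.hom.app (Opposite.op X) (F'.map g.op u') = ⟨QuotientAddGroup.mk f⟩ :=
    ULift.ext _ _ hf.symm
  rw [hf'] at hg
  have := hT.isIso_map_of_trivialFibrations L (hT.isCofibrantReplacement_cofRepMap X).2
  have hg' : inv (L.map (hT.cofRepMap X)) ≫ L.map f = g ≫ 𝟙 (L.obj Y) := congrArg ULift.down hg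
  obtain ⟨s, hs⟩ := hT.exists_lift hX (hT.isCofibrantReplacement_cofRepMap X).2 (𝟙 X)
  refine ⟨s ≫ f, ?_⟩
  have hs' : L.map s = inv (L.map (hT.cofRepMap X)) := by
    rw [← cancel_mono (L.map (hT.cofRepMap X)), ← L.map_comp, hs, L.map_id, IsIso.inv_hom_id]
  rw [L.map_comp, hs', hg', Category.comp_id]

end Localization

end IsHoveyTriple

end Abelian

section Complexes

variable {A : Type u} [Category.{v} A] [Abelian A]

/-! ### The cone of the identity -/

/-- The cone of the identity of `K`. -/
noncomputable abbrev idCone (K : ChainComplex A ℤ) : ChainComplex A ℤ :=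
  HomologicalComplex.homotopyCofiber (𝟙 K)

open HomologicalComplex in
lemma isContractible_idCone (K : ChainComplex A ℤ) : IsContractible (idCone K) := by
  -- the contraction sends the copy of `K` in the cone identically to the shifted copy
  refine ⟨{ hom := fun i j => if h : (ComplexShape.down ℤ).Rel j i then
              homotopyCofiber.sndX (𝟙 K) i ≫ homotopyCofiber.inlX (𝟙 K) i j h else 0
            zero := fun i j h => dif_neg h
            comm := fun i => ?_ }⟩
  have h₁ : (ComplexShape.down ℤ).Rel i (i - 1) := by simp
  have h₂ : (ComplexShape.down ℤ).Rel (i + 1) i := by simp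
  have h₃ : (ComplexShape.down ℤ).Rel (i - 1) (i - 1 - 1) := by simp
  rw [dNext_eq _ h₁, prevD_eq _ h₂, dif_pos h₁, dif_pos h₂]
  have e : (homotopyCofiber.d (𝟙 K) i (i - 1) ≫ homotopyCofiber.sndX (𝟙 K) (i - 1) ≫
      homotopyCofiber.inlX (𝟙 K) (i - 1) i h₁ + (homotopyCofiber.sndX (𝟙 K) i ≫
      homotopyCofiber.inlX (𝟙 K) i (i + 1) h₂) ≫ homotopyCofiber.d (𝟙 K) (i + 1) i) =
      𝟙 (homotopyCofiber.X (𝟙 K) i) := by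
    rw [homotopyCofiber.d_sndX_assoc _ _ _ h₁, Category.assoc,
      homotopyCofiber.inlX_d _ _ _ _ h₂ h₁]
    apply homotopyCofiber.ext_from_X (𝟙 K) (i - 1) i h₁ <;> simp
  simpa using! e.symm

open HomologicalComplex in
/-- The projection from the cone of the identity to the suspension. It commutes with the
differentials because both the cone and the suspension change the sign of `d` on this part. -/
noncomputable def idConeToSuspension (K : ChainComplex A ℤ) : idCone K ⟶ suspension 1 K where
  f i := homotopyCofiber.fstX (𝟙 K) i (i - 1) (by simp)
  comm' i j hij := by
    obtain rfl : j = i - 1 := by simp at hij; omega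
    have h := homotopyCofiber.d_fstX (𝟙 K) i (i - 1) (i - 1 - 1) (by simp) (by simp)
    change homotopyCofiber.fstX (𝟙 K) i (i - 1) _ ≫
        ((1 : ℤ).negOnePow • K.d (i - 1) (i - 1 - 1)) =
      homotopyCofiber.d (𝟙 K) i (i - 1) ≫ homotopyCofiber.fstX (𝟙 K) (i - 1) (i - 1 - 1) _
    rw [h, Int.negOnePow_one, Units.neg_smul, one_smul, Preadditive.comp_neg]

open HomologicalComplex in
lemma shortExact_idCone (K : ChainComplex A ℤ) :
    (ShortComplex.mk (homotopyCofiber.inr (𝟙 K)) (idConeToSuspension K) (by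
      ext i
      exact homotopyCofiber.inrX_fstX _ _ _ _)).ShortExact := by
  refine HomologicalComplex.shortExact_of_degreewise_shortExact _ fun i => ?_
  have h : (ComplexShape.down ℤ).Rel i (i - 1) := by simp
  exact ShortComplex.Splitting.shortExact
    { r := homotopyCofiber.sndX (𝟙 K) i
      s := homotopyCofiber.inlX (𝟙 K) (i - 1) i h
      f_r := homotopyCofiber.inrX_sndX _ _
      s_g := homotopyCofiber.inlX_fstX _ _ _ _
      id := by
        change homotopyCofiber.sndX (𝟙 K) i ≫ homotopyCofiber.inrX (𝟙 K) i +
          homotopyCofiber.fstX (𝟙 K) i (i - 1) h ≫ homotopyCofiber.inlX (𝟙 K) (i - 1) i h = 𝟙 _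
        apply homotopyCofiber.ext_from_X (𝟙 K) (i - 1) i h <;> simp }

/-- A null-homotopic chain map factors through the cone of the identity of its source. -/
lemma exists_idCone_fac {K L : ChainComplex A ℤ} {f : K ⟶ L} (h : Homotopy f 0) :
    ∃ g : idCone K ⟶ L, HomologicalComplex.homotopyCofiber.inr (𝟙 K) ≫ g = f :=
  ⟨HomologicalComplex.homotopyCofiber.desc _ f ((Homotopy.ofEq (Category.id_comp f)).trans h),
    HomologicalComplex.homotopyCofiber.inr_desc _ _ _⟩

/-- If the cone of the identity splits off `K`, then `K` is contractible. -/
lemma isContractible_of_extOneVanishes {K : ChainComplex A ℤ}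
    (h : ExtOneVanishes (suspension 1 K) K) : IsContractible K := by
  obtain ⟨s⟩ := h _ _ _ (shortExact_idCone K)
  have hs : HomologicalComplex.homotopyCofiber.inr (𝟙 K) ≫ s.r = 𝟙 K := s.f_r
  obtain ⟨H⟩ := isContractible_idCone K
  have := (H.compLeft (HomologicalComplex.homotopyCofiber.inr (𝟙 K))).compRight s.r
  exact ⟨(Homotopy.ofEq (by simp [hs])).trans (this.trans (Homotopy.ofEq (by simp)))⟩

/-! ### Chain homotopy and the core -/

lemma homotopic_zero_of_fac {K M L : ChainComplex A ℤ} (hM : IsContractible M) (a : K ⟶ M)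
    (b : M ⟶ L) : Nonempty (Homotopy (a ≫ b) 0) := by
  obtain ⟨H⟩ := hM
  exact ⟨(Homotopy.ofEq (by simp)).trans (((H.compLeft a).compRight b).trans
    (Homotopy.ofEq (by simp)))⟩

namespace IsHoveyTriple

variable {Q W R : ObjectProperty (ChainComplex A ℤ)}

lemma isContractible_of_core (hT : IsHoveyTriple Q W R)
    (hcore : ∀ (n : ℤ) (X : ChainComplex A ℤ),
      core Q W R X → core Q W R (suspension n X)) {X : ChainComplex A ℤ} (hX : core Q W R X) :
    IsContractible X :=
  isContractible_of_extOneVanishes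
    (hT.cof_trivFib.vanishes (hcore 1 X hX).1.1 ⟨hX.1.2, hX.2⟩)

lemma sub_mem_coreMaps_iff_homotopic (hT : IsHoveyTriple Q W R)
    (hc : ∀ X : ChainComplex A ℤ, core Q W R X → IsContractible X)
    (hW : ∀ X : ChainComplex A ℤ, IsContractible X → W X) {X Y : ChainComplex A ℤ} (hX : Q X)
    (hY : R Y) (f g : X ⟶ Y) : f - g ∈ hT.coreMaps X Y ↔ Nonempty (Homotopy f g) := by
  constructor
  · rintro ⟨M, a, b, hM, h⟩
    obtain ⟨H⟩ := homotopic_zero_of_fac (hc M hM) a b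
    exact ⟨(Homotopy.equivSubZero).symm (h ▸ H)⟩
  · rintro ⟨H⟩
    obtain ⟨k, hk⟩ := exists_idCone_fac (Homotopy.equivSubZero H)
    rw [← hk]
    exact hT.comp_mem_coreMaps_of_W hX (hW _ (isContractible_idCone X)) hY _ _

section Localization

variable {D : Type u'} [Category.{v'} D] (L : ChainComplex A ℤ ⥤ D)
  [L.IsLocalization (weakEquivalences Q W R)]

/-- Null-homotopic maps factor through a cone, which is in `W`; no condition on the source and
target is needed. -/
lemma map_eq_of_homotopy (hT : IsHoveyTriple Q W R)
    (hW : ∀ X : ChainComplex A ℤ, IsContractible X → W X) {X Y : ChainComplex A ℤ} {f g : X ⟶ Y}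
    (H : Homotopy f g) : L.map f = L.map g := by
  obtain ⟨k, hk⟩ := exists_idCone_fac (Homotopy.equivSubZero H)
  exact hT.map_eq_of_sub_eq_comp L (hW _ (isContractible_idCone X)) _ k hk.symm

/-- Chain homotopy classes of maps from a cofibrant to a fibrant complex, as morphisms in the
localization. -/
noncomputable def homotopyClassesEquiv (hT : IsHoveyTriple Q W R)
    (hc : ∀ X : ChainComplex A ℤ, core Q W R X → IsContractible X)
    (hW : ∀ X : ChainComplex A ℤ, IsContractible X → W X) {X Y : ChainComplex A ℤ} (hX : Q X)
    (hY : R Y) : HomotopyClasses X Y ≃ (L.obj X ⟶ L.obj Y) :=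
  Equiv.ofBijective
    (Quot.lift (fun f => L.map f) fun _ _ ⟨H⟩ => hT.map_eq_of_homotopy L hW H) (by
      constructor
      · rintro ⟨f⟩ ⟨g⟩ h
        exact Quot.sound ((hT.sub_mem_coreMaps_iff_homotopic hc hW hX hY f g).1
          (hT.sub_mem_coreMaps_of_map_eq L hX hY h))
      · intro g
        obtain ⟨f, hf⟩ := hT.map_surjective L hX hY g
        exact ⟨Quot.mk _ f, hf⟩)

/-- The functor from the homotopy category of chain complexes induced by a localization functor. -/
noncomputable def fromHomotopyCategory (hT : IsHoveyTriple Q W R)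
    (hW : ∀ X : ChainComplex A ℤ, IsContractible X → W X) :
    HomotopyCategory A (ComplexShape.down ℤ) ⥤ D :=
  CategoryTheory.Quotient.lift _ L fun _ _ _ _ ⟨H⟩ => hT.map_eq_of_homotopy L hW H

/-- The functor `K(Q ⊓ R) ⥤ D` induced by a localization functor. -/
noncomputable def fromK (hT : IsHoveyTriple Q W R)
    (hW : ∀ X : ChainComplex A ℤ, IsContractible X → W X) : K (Q ⊓ R) ⥤ D :=
  (homotopyObjects (Q ⊓ R)).ι ⋙ hT.fromHomotopyCategory L hW

lemma isEquivalence_fromK (hT : IsHoveyTriple Q W R)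
    (hc : ∀ X : ChainComplex A ℤ, core Q W R X → IsContractible X)
    (hW : ∀ X : ChainComplex A ℤ, IsContractible X → W X) :
    (hT.fromK L hW).IsEquivalence where
  faithful := ⟨by
    rintro ⟨⟨X⟩, hX⟩ ⟨⟨Y⟩, hY⟩ ⟨f⟩ ⟨g⟩ h
    obtain ⟨f, rfl⟩ := (HomotopyCategory.quotient A _).map_surjective f
    obtain ⟨g, rfl⟩ := (HomotopyCategory.quotient A _).map_surjective g
    obtain ⟨H⟩ := (hT.sub_mem_coreMaps_iff_homotopic hc hW hX.1 hY.2 f g).1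
      (hT.sub_mem_coreMaps_of_map_eq L hX.1 hY.2 h)
    congr 1
    exact HomotopyCategory.eq_of_homotopy _ _ H⟩
  full := ⟨by
    rintro ⟨⟨X⟩, hX⟩ ⟨⟨Y⟩, hY⟩ g
    obtain ⟨f, hf⟩ := hT.map_surjective L hX.1 hY.2 g
    exact ⟨⟨(HomotopyCategory.quotient A _).map f⟩, hf⟩⟩
  essSurj := ⟨fun Z => by
    have := Localization.essSurj L (weakEquivalences Q W R)
    -- a fibrant replacement of a cofibrant object is still cofibrant
    obtain ⟨X', p, hX', hp⟩ := hT.exists_cofibrantReplacement (L.objPreimage Z)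
    obtain ⟨Y, i, hY, hi⟩ := hT.exists_fibrantReplacement X'
    have hQ : Q Y := by
      obtain ⟨_, hi⟩ := hi
      exact hT.cof_trivFib.left_of_shortExact (shortExact_cokernel i) hX' hi.1
    have := hT.isIso_map_of_trivialFibrations L hp
    have := hT.isIso_map_of_trivialCofibrations L hi
    exact ⟨⟨⟨Y⟩, hQ, hY⟩,
      ⟨(asIso (L.map i)).symm ≪≫ asIso (L.map p) ≪≫ L.objObjPreimageIso Z⟩⟩⟩

end Localization

end IsHoveyTriple

end Complexes

end HoveyModel

theorem mainTheorem3 {A : Type u} [Category.{v} A] [Abelian A]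
    (Q W R : ObjectProperty (ChainComplex A ℤ))
    (hT : HoveyModel.IsHoveyTriple Q W R)
    (hcore : ∀ (n : ℤ) (X : ChainComplex A ℤ),
      HoveyModel.core Q W R X → HoveyModel.core Q W R (HoveyModel.suspension n X)) :
    (∀ X : ChainComplex A ℤ, HoveyModel.core Q W R X → HoveyModel.IsContractible X) ∧
    ((∀ X : ChainComplex A ℤ, HoveyModel.IsContractible X → W X) →
      -- `L : Ch(A) ⥤ Ho` is any localization of `Ch(A)` at the weak equivalences
      ∀ {Ho : Type u'} [Category.{v'} Ho] (L : ChainComplex A ℤ ⥤ Ho)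
        [L.IsLocalization (HoveyModel.weakEquivalences Q W R)],
        (∀ {X Y QX RY : ChainComplex A ℤ} (p : QX ⟶ X) (i : Y ⟶ RY),
          HoveyModel.IsCofibrantReplacement Q W R p →
          HoveyModel.IsFibrantReplacement Q W R i →
          ∃ e : HoveyModel.HomotopyClasses QX RY ≃ (L.obj X ⟶ L.obj Y),
            ∀ f : QX ⟶ RY, L.map p ≫ e (Quot.mk _ f) ≫ L.map i = L.map f) ∧
        (∃ e : HoveyModel.K (Q ⊓ R) ≌ Ho,
          Nonempty (HoveyModel.toK (Q ⊓ R) ⋙ e.functor ≅ (Q ⊓ R).ι ⋙ L))) := by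
  have hc : ∀ X : ChainComplex A ℤ, HoveyModel.core Q W R X → HoveyModel.IsContractible X :=
    fun X hX => hT.isContractible_of_core hcore hX
  refine ⟨hc, fun hW Ho _ L _ => ⟨fun {X Y QX RY} p i hp hi => ?_, ?_⟩⟩
  · have := hT.isIso_map_of_trivialFibrations L hp.2
    have := hT.isIso_map_of_trivialCofibrations L hi.2
    refine ⟨(hT.homotopyClassesEquiv L hc hW hp.1 hi.1).trans
      ((asIso (L.map p)).homCongr (asIso (L.map i)).symm), fun f => ?_⟩
    change L.map p ≫ (inv (L.map p) ≫ L.map f ≫ inv (L.map i)) ≫ L.map i = L.map f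
    simp
  · have := hT.isEquivalence_fromK L hc hW
    exact ⟨(hT.fromK L hW).asEquivalence, ⟨Iso.refl _⟩⟩
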